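/- **Setting.** Fix $\mu\in\mathbb R$ and a nonempty set $\Xi$ of probability laws on $\mathbb R$ with mean $0$ and variance $1$ whose second moments are uniformly integrable, that is $\sup_{\nu\in\Xi}\int_{|x|\ge K}x^2\,\nu(dx)\to0$ as $K\to\infty$ (this is automatic if $\Xi$ is finite). For every block length $m$, data $X_1,\dots,X_n$ with $n=n(m)$ are observed, where $m<n(m)\le Cm$ for some constant $C$ and all large $m$. A *configuration* $\theta$ consists of a partition of $\{1,\dots,n\}$ into consecutive sub-samples of arbitrary, possibly unequal, lengths, each greater than $m$, and, for each sub-sample $i$, a standard deviation $\sigma_i\in[\underline\sigma,\overline\sigma]$ and a noise law $\nu_i\in\Xi$. Under the corresponding law $P_\theta$ (with expectation $E_\theta$) all observations are independent, and those of sub-sample $i$ are distributed as $\mu+\sigma_i\varepsilon$ with $\varepsilon\sim\nu_i$. The number of sub-samples, the change points, the $\sigma_i$ and the $\nu_i$ are unknown. Let $\hat{\mathbb E}_m=\hat{\mathbb E}_m^{\underline\sigma,\overline\sigma}$ be the sublinear expectation $\hat{\mathbb E}_m[T]=\sup_\theta E_\theta[T]$, the supremum being over all configurations with standard deviations in $[\underline\sigma,\overline\sigma]$.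 For $1\le l\le n-m+1$ let $\bar X_{nl}=\frac1m\sum_{j=l}^{l+m-1}X_j$ and $\tilde S^2_{nl}=\frac1{m-1}\sum_{j=l}^{l+m-1}(X_j-\bar X_{nl})^2$, and put $$\tilde{\overline\sigma}^2=\max_{1\le l\le n-m+1}\tilde S^2_{nl},\qquad \tilde{\underline\sigma}^2=\min_{1\le l\le n-m+1}\tilde S^2_{nl}.$$ A sequence $T=(T_m)$ of statistics of $(X_1,\dots,X_{n(m)})$ is called *asymptotically unbiased for the upper variance* if, for all $0<\underline\sigma\le\overline\sigma$, $T_m$ is integrable under every configuration for all large $m$ and $\hat{\mathbb E}_m[T_m]\to\overline\sigma^2$; it is *asymptotically unbiased for the lower variance* if, likewise, $-\hat{\mathbb E}_m[-T_m]\to\underline\sigma^2$. It is a *Lipschitz block statistic* if $T_m=f_m(\tilde S^2_{n1},\dots,\tilde S^2_{n,n-m+1})$ with functions $f_m$ that are Lipschitz for the maximum norm with a constant independent of $m$. **Statement.** As $m\to\infty$, $\tilde{\overline\sigma}^2$ is asymptotically the largest unbiased estimator of the upper variance: 1. $\tilde{\overline\sigma}^2$ is a Lipschitz block statistic and is asymptotically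 unbiased for the upper variance. 2. If $T$ is any Lipschitz block statistic that is asymptotically unbiased for the upper variance, then for all $0<\underline\sigma\le\overline\sigma$, $(T_m-\tilde{\overline\sigma}^2)^+$ is integrable under every configuration for all large $m$, and $\hat{\mathbb E}_m[(T_m-\tilde{\overline\sigma}^2)^+]\to0$. 3. If $T$ is any sequence of statistics of the data that is asymptotically unbiased for the upper variance, then for all $0<\underline\sigma\le\overline\sigma$ and $\epsilon>0$ we have, for all large $m$, $E_\theta[T_m]\le E_\theta[\tilde{\overline\sigma}^2]+\epsilon$ for every configuration $\theta$ with standard deviations in $[\underline\sigma,\overline\sigma]$. 4. Moreover, $\sup_\theta\bigl|E_\theta[\tilde{\overline\sigma}^2]-\max_i\sigma_i^2\bigr|\to0$ for all $0\le\underline\sigma\le\overline\sigma$, the supremum being over all configurations with standard deviations in $[\underline\sigma,\overline\sigma]$. Similarly, $\tilde{\underline\sigma}^2$ is asymptotically the smallest unbiased estimator of the lower variance: it is a Lipschitz block statistic and asymptotically unbiased for the lower variance; $(\tilde{\underline\sigma}^2-T_m)^+$ is integrable under every configuration for all large $m$ and $\hat{\mathbb E}_m[(\tilde{\underline\sigma}^2-T_m)^+]\to0$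 for every Lipschitz block statistic $T$ that is asymptotically unbiased for the lower variance; $E_\theta[\tilde{\underline\sigma}^2]\le E_\theta[T_m]+\epsilon$ for all large $m$, uniformly in $\theta$, for every $T$ that is asymptotically unbiased for the lower variance; and $\sup_\theta|E_\theta[\tilde{\underline\sigma}^2]-\min_i\sigma_i^2|\to0$; the quantification over $\underline\sigma,\overline\sigma$ and $\epsilon$ being the same as in 1-4. -/

import Mathlib

open MeasureTheory Filter Topology

noncomputable section

namespace MovingBlock

/-- A class `Ξ` of admissible noise laws: standardised (mean `0`, variance `1`) probability
laws on `ℝ` whose second moments are uniformly integrable.  Every nonempty finite set of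
standardised laws with finite second moment is such a class, and so is a single law. -/
structure IsNoiseClass (Ξ : Set (Measure ℝ)) : Prop where
  nonempty : Ξ.Nonempty
  prob : ∀ ν ∈ Ξ, IsProbabilityMeasure ν
  memLp : ∀ ν ∈ Ξ, MemLp (fun x : ℝ => x) 2 ν
  mean_zero : ∀ ν ∈ Ξ, ∫ x, x ∂ν = 0
  var_one : ∀ ν ∈ Ξ, ∫ x, x ^ 2 ∂ν = 1
  unif_sq_integrable : ∀ ε > 0, ∃ K : ℝ, ∀ ν ∈ Ξ, ∫ x in {x : ℝ | K ≤ |x|}, x ^ 2 ∂ν ≤ ε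

/-- A configuration of `n` pooled observations, unknown to the statistician: the number of
sub-samples and their lengths (a composition of `n`), all longer than `m`, and for each
sub-sample its standard deviation, in `[σl, σu]`, and its noise law, in `Ξ`. -/
structure Config (Ξ : Set (Measure ℝ)) (σl σu : ℝ) (n m : ℕ) where
  parts : Composition n
  long : ∀ i, m < parts.blocksFun i
  sd : Fin parts.length → ℝ
  sd_mem : ∀ i, sd i ∈ Set.Icc σl σu
  noise : Fin parts.length → Measure ℝ
  noise_mem : ∀ i, noise i ∈ Ξ

namespace Config

variable {Ξ : Set (Measure ℝ)} {σl σu : ℝ} {n m : ℕ}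

/-- The joint law of the data `X₁, …, Xₙ` under a configuration: independent observations,
those of the `i`-th sub-sample being distributed as `μ + σᵢ ε` with `ε` of law `noise i`. -/
def law (θ : Config Ξ σl σu n m) (μ : ℝ) : Measure (Fin n → ℝ) :=
  Measure.pi fun j : Fin n =>
    (θ.noise (θ.parts.index j)).map fun e : ℝ => μ + θ.sd (θ.parts.index j) * e

/-- The largest of the variances of the sub-samples. -/
def maxVar (θ : Config Ξ σl σu n m) : ℝ := ⨆ i, θ.sd i ^ 2

/-- The smallest of the variances of the sub-samples. -/
def minVar (θ : Config Ξ σl σu n m) : ℝ := ⨅ i, θ.sd i ^ 2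

end Config

/-- The sublinear expectation under uncertainty of the variances (within `[σl², σu²]`), of the
number of sub-samples and of the change points: the supremum of the linear expectations over all
configurations. -/
def upperExp (Ξ : Set (Measure ℝ)) (μ σl σu : ℝ) (n m : ℕ) (T : (Fin n → ℝ) → ℝ) : EReal :=
  ⨆ θ : Config Ξ σl σu n m, ((∫ x, T x ∂(θ.law μ) : ℝ) : EReal)

/-- `T` is integrable under every configuration. -/
def IntegrableAll (Ξ : Set (Measure ℝ)) (μ σl σu : ℝ) (n m : ℕ) (T : (Fin n → ℝ) → ℝ) : Prop :=
  ∀ θ : Config Ξ σl σu n m, Integrable T (θ.law μ)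

/-- The positions `l, l + 1, …, l + m - 1` (counted from `0`) of the `l`-th moving block. -/
def block {n : ℕ} (m l : ℕ) : Finset (Fin n) :=
  Finset.univ.filter fun j : Fin n => l ≤ (j : ℕ) ∧ (j : ℕ) < l + m

/-- The sample mean of the `l`-th moving block. -/
def blockMean {n : ℕ} (m : ℕ) (x : Fin n → ℝ) (l : ℕ) : ℝ :=
  (∑ j ∈ block m l, x j) / m

/-- The sample variances of the `n - m + 1` overlapping moving blocks of length `m`. -/
def blockVar {n : ℕ} (m : ℕ) (x : Fin n → ℝ) (l : Fin (n - m + 1)) : ℝ :=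
  (∑ j ∈ block m l, (x j - blockMean m x l) ^ 2) / ((m : ℝ) - 1)

/-- The moving-block estimator of the upper variance. -/
def mbMax {n : ℕ} (m : ℕ) (x : Fin n → ℝ) : ℝ :=
  Finset.univ.sup' Finset.univ_nonempty (blockVar m x)

/-- The moving-block estimator of the lower variance. -/
def mbMin {n : ℕ} (m : ℕ) (x : Fin n → ℝ) : ℝ :=
  Finset.univ.inf' Finset.univ_nonempty (blockVar m x)

/-- A statistic, for every block length `m`, of the `n m` observed data. -/
abbrev Statistic (n : ℕ → ℕ) : Type := ∀ m : ℕ, (Fin (n m) → ℝ) → ℝ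

/-- `T` is an asymptotically unbiased estimator of the upper variance under the sublinear
expectation: `Ê[T] → σu²`, whatever the unknown bounds `0 < σl ≤ σu` are. -/
def AsympUnbiasedUpper (Ξ : Set (Measure ℝ)) (μ : ℝ) (n : ℕ → ℕ) (T : Statistic n) : Prop :=
  ∀ σl σu : ℝ, 0 < σl → σl ≤ σu →
    (∀ᶠ m in atTop, IntegrableAll Ξ μ σl σu (n m) m (T m)) ∧
    Tendsto (fun m => upperExp Ξ μ σl σu (n m) m (T m)) atTop (𝓝 ((σu ^ 2 : ℝ) : EReal))

/-- `T` is an asymptotically unbiased estimator of the lower variance under the sublinear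
expectation: `-Ê[-T] → σl²`, whatever the unknown bounds `0 < σl ≤ σu` are. -/
def AsympUnbiasedLower (Ξ : Set (Measure ℝ)) (μ : ℝ) (n : ℕ → ℕ) (T : Statistic n) : Prop :=
  ∀ σl σu : ℝ, 0 < σl → σl ≤ σu →
    (∀ᶠ m in atTop, IntegrableAll Ξ μ σl σu (n m) m (T m)) ∧
    Tendsto (fun m => -upperExp Ξ μ σl σu (n m) m (fun x => -T m x)) atTop
      (𝓝 ((σl ^ 2 : ℝ) : EReal))

/-- `T ≤ U` asymptotically under the sublinear expectation: `Ê[(T - U)⁺] → 0`. -/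
def AsympLE (Ξ : Set (Measure ℝ)) (μ : ℝ) (n : ℕ → ℕ) (T U : Statistic n) : Prop :=
  ∀ σl σu : ℝ, 0 < σl → σl ≤ σu →
    (∀ᶠ m in atTop, IntegrableAll Ξ μ σl σu (n m) m (fun x => max (T m x - U m x) 0)) ∧
    Tendsto (fun m => upperExp Ξ μ σl σu (n m) m (fun x => max (T m x - U m x) 0)) atTop (𝓝 0)

/-- `T ≤ U` asymptotically in mean, uniformly over all configurations. -/
def AsympLEMean (Ξ : Set (Measure ℝ)) (μ : ℝ) (n : ℕ → ℕ) (T U : Statistic n) : Prop :=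
  ∀ σl σu : ℝ, 0 < σl → σl ≤ σu → ∀ ε > 0, ∀ᶠ m in atTop,
    ∀ θ : Config Ξ σl σu (n m) m, ∫ x, T m x ∂(θ.law μ) ≤ ∫ x, U m x ∂(θ.law μ) + ε

/-- `T m` is a function `f m` of the moving-block variances, the `f m` being Lipschitz for the
maximum norm with one constant for all `m`. -/
def IsLipschitzBlockStatistic (n : ℕ → ℕ) (T : Statistic n) : Prop :=
  ∃ (K : NNReal) (f : ∀ m : ℕ, (Fin (n m - m + 1) → ℝ) → ℝ),
    (∀ m, LipschitzWith K (f m)) ∧ ∀ m x, T m x = f m (blockVar m x)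

/-- `U` is asymptotically the largest unbiased estimator of the upper variance: it is one of the
asymptotically unbiased Lipschitz statistics of the block variances, it dominates all the others,
and in mean it dominates every asymptotically unbiased statistic of the data. -/
structure IsAsympLargestUnbiasedUpper (Ξ : Set (Measure ℝ)) (μ : ℝ) (n : ℕ → ℕ)
    (U : Statistic n) : Prop where
  lipschitz : IsLipschitzBlockStatistic n U
  unbiased : AsympUnbiasedUpper Ξ μ n U
  largest : ∀ T : Statistic n, IsLipschitzBlockStatistic n T →
    AsympUnbiasedUpper Ξ μ n T → AsympLE Ξ μ n T U
  largest_mean : ∀ T : Statistic n, AsympUnbiasedUpper Ξ μ n T → AsympLEMean Ξ μ n T U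

/-- `U` is asymptotically the smallest unbiased estimator of the lower variance. -/
structure IsAsympSmallestUnbiasedLower (Ξ : Set (Measure ℝ)) (μ : ℝ) (n : ℕ → ℕ)
    (U : Statistic n) : Prop where
  lipschitz : IsLipschitzBlockStatistic n U
  unbiased : AsympUnbiasedLower Ξ μ n U
  smallest : ∀ T : Statistic n, IsLipschitzBlockStatistic n T →
    AsympUnbiasedLower Ξ μ n T → AsympLE Ξ μ n U T
  smallest_mean : ∀ T : Statistic n, AsympUnbiasedLower Ξ μ n T → AsympLEMean Ξ μ n U T

/-- Asymptotic unbiasedness under the linear expectation of each single configuration: the mean of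
`U` approaches the parameter `p` of the true configuration, uniformly over all configurations. -/
def AsympUnbiasedAt (Ξ : Set (Measure ℝ)) (μ : ℝ) (n : ℕ → ℕ) (U : Statistic n)
    (p : ∀ {σl σu : ℝ} {n m : ℕ}, Config Ξ σl σu n m → ℝ) : Prop :=
  ∀ σl σu : ℝ, 0 ≤ σl → σl ≤ σu → ∀ ε > 0, ∀ᶠ m in atTop,
    ∀ θ : Config Ξ σl σu (n m) m, |∫ x, U m x ∂(θ.law μ) - p θ| ≤ ε

end MovingBlock

end

/-! Everything rests on one uniform law of large numbers: in `L¹`, uniformly over configurations,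
all block variances are simultaneously close to the averages of the true variances over their blocks
(`eventually_config_close`). Only second moments are available, so the squared deviations are
truncated. The bounded part is handled by a maximal inequality for moving sums; the tails are
nonnegative, so their sum over any block is at most the sum over the whole sample, which is small in
mean by uniform integrability and `n ≤ C * m`.

The largest block average is exactly `maxVar`: an average never exceeds the maximum, and a
sub-sample longer than `m` contains a whole block. Hence `mbMax` converges in `L¹` to `maxVar`,
uniformly.

Optimality comes from requiring unbiasedness for every pair of bounds. A configuration with maximal
variance `v` is also a configuration for the smaller upper bound `√v`, so an unbiased `T` cannot
have mean much above `v` (`AsympUnbiasedUpper.eventually_integral_le`). This gives the comparison in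
mean. A Lipschitz block statistic moreover concentrates at the constant `f m θ.blockAvg`, so the
bound on its mean bounds that constant, and `(T - mbMax)⁺` vanishes in mean. The lower variance is
symmetric. -/

noncomputable section

namespace MovingBlock

/-! ### Maximal inequality for moving sums of independent variables. -/

section ProductSums

variable {n : ℕ} {ρ : Fin n → Measure ℝ} [∀ j, IsProbabilityMeasure (ρ j)] {g : Fin n → ℝ → ℝ}

lemma memLp_sum_eval (hg : ∀ j, MemLp (g j) 2 (ρ j)) (s : Finset (Fin n)) :
    MemLp (fun x => ∑ j ∈ s, g j (x j)) 2 (Measure.pi ρ) :=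
  memLp_finsetSum s fun j _ => (hg j).comp_measurePreserving (measurePreserving_eval ρ j)

/-- The second moment of a sum of independent centred variables is the sum of the second
moments. -/
lemma integral_sq_sum_eval_le (hg : ∀ j, MemLp (g j) 2 (ρ j)) (h0 : ∀ j, ∫ y, g j y ∂(ρ j) = 0)
    {V : ℝ} (hV : ∀ j, ∫ y, g j y ^ 2 ∂(ρ j) ≤ V) (s : Finset (Fin n)) :
    ∫ x, (∑ j ∈ s, g j (x j)) ^ 2 ∂(Measure.pi ρ) ≤ n * V := by
  classical
  -- Extending by zero off `s` makes this a sum over all coordinates, to which the variance formula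
  -- for product measures applies.
  set X : Fin n → ℝ → ℝ := fun j => if j ∈ s then g j else fun _ => 0 with hX
  have hXm : ∀ j, MemLp (X j) 2 (ρ j) := by
    intro j
    by_cases hj : j ∈ s
    · simpa [hX, hj] using hg j
    · simp [hX, hj]
  have hX0 : ∀ j, ∫ y, X j y ∂(ρ j) = 0 := by
    intro j
    by_cases hj : j ∈ s <;> simp [hX, hj, h0]
  have hXV : ∀ j, ∫ y, X j y ^ 2 ∂(ρ j) ≤ V := by
    intro j
    by_cases hj : j ∈ s
    · simpa [hX, hj] using hV j
    · simpa [hX, hj] using (integral_nonneg fun y => sq_nonneg (g j y)).trans (hV j)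
  have hsum : ∀ x : Fin n → ℝ, (∑ j, fun ω : Fin n → ℝ => X j (ω j)) x = ∑ j ∈ s, g j (x j) := by
    intro x
    rw [Finset.sum_apply, ← Finset.sum_filter_add_sum_filter_not Finset.univ (· ∈ s)]
    have h1 : ∑ j with j ∉ s, X j (x j) = 0 :=
      Finset.sum_eq_zero fun j hj => by simp [hX, (Finset.mem_filter.1 hj).2]
    rw [h1, add_zero, Finset.filter_univ_mem]
    exact Finset.sum_congr rfl fun j hj => by simp [hX, hj]
  have hmeas : AEMeasurable (∑ j, fun ω : Fin n → ℝ => X j (ω j)) (Measure.pi ρ) := by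
    have := (memLp_sum_eval hXm Finset.univ).aestronglyMeasurable.aemeasurable
    convert this using 1
    ext x
    simp
  have hmean : ∫ x, (∑ j, fun ω : Fin n → ℝ => X j (ω j)) x ∂(Measure.pi ρ) = 0 := by
    simp only [Finset.sum_apply]
    rw [integral_finsetSum _ fun j _ =>
      integrable_comp_eval ((hXm j).integrable one_le_two)]
    exact Finset.sum_eq_zero fun j _ => by
      rw [integral_comp_eval (hXm j).aestronglyMeasurable, hX0]
  have hvar := ProbabilityTheory.variance_sum_pi hXm
  rw [ProbabilityTheory.variance_of_integral_eq_zero hmeas hmean] at hvar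
  simp only [hsum] at hvar
  rw [hvar]
  calc ∑ j, ProbabilityTheory.variance (X j) (ρ j) ≤ ∑ _j : Fin n, V := by
        refine Finset.sum_le_sum fun j _ => ?_
        rw [ProbabilityTheory.variance_of_integral_eq_zero
          (hXm j).aestronglyMeasurable.aemeasurable (hX0 j)]
        exact hXV j
    _ = n * V := by simp

/-- Indices below `k`. -/
def below (n k : ℕ) : Finset (Fin n) := Finset.univ.filter fun j => (j : ℕ) < k

lemma sum_block_eq (a : Fin n → ℝ) (m l : ℕ) :
    ∑ j ∈ block m l, a j = ∑ j ∈ below n (l + m), a j - ∑ j ∈ below n l, a j := by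
  have hd : below n (l + m) = below n l ∪ block m l := by
    ext j
    simp only [below, block, Finset.mem_union, Finset.mem_filter, Finset.mem_univ, true_and]
    omega
  have hdis : Disjoint (below n l) (block m l) := by
    rw [Finset.disjoint_left]
    intro j hj hj'
    simp only [below, block, Finset.mem_filter, Finset.mem_univ, true_and] at hj hj'
    omega
  rw [hd, Finset.sum_union hdis]
  ring

lemma card_block_le (m l : ℕ) : (block m l : Finset (Fin n)).card ≤ m := by
  have h := Finset.card_le_card_of_injOn (s := (block m l : Finset (Fin n)))
    (t := Finset.Ico l (l + m)) (fun j => (j : ℕ))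
    (fun j hj => by simpa [block] using hj) (fun i _ j _ h => Fin.ext h)
  simpa using h

lemma card_block {m l : ℕ} (h : l + m ≤ n) : (block m l : Finset (Fin n)).card = m := by
  refine le_antisymm (card_block_le m l) ?_
  have := Finset.card_le_card_of_surjOn (s := (block m l : Finset (Fin n)))
    (t := Finset.Ico l (l + m)) (fun j => (j : ℕ)) (fun i hi => by
      have hi' : l ≤ i ∧ i < l + m := by simpa using hi
      exact ⟨⟨i, by omega⟩, by simpa [block] using hi', rfl⟩)
  simpa using this

/-- Round `k` down to a multiple of `s`: the partial sum there is one of only `n / s + 1` grid sums,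
and the fewer than `s` remaining terms are controlled by Cauchy-Schwarz. The bound does not depend
on `k`. -/
lemma sq_sum_below_le (a : Fin n → ℝ) {s k : ℕ} (hs : 0 < s) (hk : k ≤ n) :
    (∑ j ∈ below n k, a j) ^ 2 ≤
      2 * ∑ i ∈ Finset.range (n / s + 1), (∑ j ∈ below n (i * s), a j) ^ 2 +
        2 * (s * ∑ j, a j ^ 2) := by
  have hmod : k / s * s + k % s = k := by rw [mul_comm]; exact Nat.div_add_mod k s
  have hsplit := sum_block_eq a (k % s) (k / s * s)
  rw [hmod] at hsplit
  set G := ∑ j ∈ below n (k / s * s), a j with hG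
  set D := ∑ j ∈ (block (k % s) (k / s * s) : Finset (Fin n)), a j with hD
  have h1 : G ^ 2 ≤ ∑ i ∈ Finset.range (n / s + 1), (∑ j ∈ below n (i * s), a j) ^ 2 :=
    Finset.single_le_sum (f := fun i => (∑ j ∈ below n (i * s), a j) ^ 2)
      (fun i _ => sq_nonneg _)
      (Finset.mem_range.2 (Nat.lt_succ_of_le (Nat.div_le_div_right hk)))
  have h2 : D ^ 2 ≤ s * ∑ j, a j ^ 2 := by
    refine sq_sum_le_card_mul_sum_sq.trans ?_
    refine mul_le_mul ?_ ?_ (Finset.sum_nonneg fun _ _ => sq_nonneg _) (Nat.cast_nonneg _)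
    · exact_mod_cast (card_block_le _ _).trans (Nat.mod_lt k hs).le
    · exact Finset.sum_le_univ_sum_of_nonneg fun j => sq_nonneg (a j)
  have h3 : ∑ j ∈ below n k, a j = G + D := by linarith
  rw [h3]
  nlinarith [sq_nonneg (G - D)]

/-- Maximal inequality for the moving sums of independent centred variables. -/
lemma exists_maximal_block (hg : ∀ j, MemLp (g j) 2 (ρ j)) (h0 : ∀ j, ∫ y, g j y ∂(ρ j) = 0)
    {V : ℝ} (hV : ∀ j, ∫ y, g j y ^ 2 ∂(ρ j) ≤ V) (m : ℕ) {s : ℕ} (hs : 0 < s) :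
    ∃ M : (Fin n → ℝ) → ℝ, Integrable M (Measure.pi ρ) ∧
      (∀ x l, l + m ≤ n → (∑ j ∈ block m l, g j (x j)) ^ 2 ≤ M x) ∧
      ∫ x, M x ∂(Measure.pi ρ) ≤ 8 * (n * V) * (((n / s : ℕ) : ℝ) + 1 + s) := by
  have hi1 : ∀ i, Integrable (fun x : Fin n → ℝ => (∑ j ∈ below n (i * s), g j (x j)) ^ 2)
      (Measure.pi ρ) := fun i => (memLp_sum_eval hg _).integrable_sq
  have hi2 : ∀ j, Integrable (fun x : Fin n → ℝ => g j (x j) ^ 2) (Measure.pi ρ) :=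
    fun j => integrable_comp_eval (μ := ρ) (i := j) (f := fun y => g j y ^ 2) (hg j).integrable_sq
  -- A moving sum is a difference `A - B` of partial sums; `(A - B)² ≤ 2A² + 2B²` and the factor 2
  -- in `sq_sum_below_le` for each give 8.
  have hI1 : Integrable (fun x : Fin n → ℝ => 8 * ∑ i ∈ Finset.range (n / s + 1),
      (∑ j ∈ below n (i * s), g j (x j)) ^ 2) (Measure.pi ρ) :=
    (integrable_finsetSum _ fun i _ => hi1 i).const_mul 8
  have hI2 : Integrable (fun x : Fin n → ℝ => 8 * (s * ∑ j, g j (x j) ^ 2)) (Measure.pi ρ) :=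
    ((integrable_finsetSum _ fun i _ => hi2 i).const_mul (s : ℝ)).const_mul 8
  refine ⟨_, hI1.add hI2, ?_, ?_⟩
  · intro x l hl
    rw [sum_block_eq]
    have h1 := sq_sum_below_le (fun j => g j (x j)) hs hl
    have h2 := sq_sum_below_le (fun j => g j (x j)) hs ((Nat.le_add_right l m).trans hl)
    simp only [Pi.add_apply]
    nlinarith [sq_nonneg (∑ j ∈ below n (l + m), g j (x j) + ∑ j ∈ below n l, g j (x j))]
  · simp only [Pi.add_apply]
    rw [integral_add hI1 hI2, integral_const_mul, integral_const_mul, integral_const_mul,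
      integral_finsetSum _ fun i _ => hi1 i, integral_finsetSum _ fun i _ => hi2 i]
    have b1 : ∑ i ∈ Finset.range (n / s + 1),
        ∫ x, (∑ j ∈ below n (i * s), g j (x j)) ^ 2 ∂(Measure.pi ρ)
          ≤ (((n / s : ℕ) : ℝ) + 1) * (n * V) := by
      refine (Finset.sum_le_sum fun i _ => integral_sq_sum_eval_le hg h0 hV _).trans ?_
      simp
    have b2 : ∑ j, ∫ x : Fin n → ℝ, g j (x j) ^ 2 ∂(Measure.pi ρ) ≤ n * V := by
      have : ∀ j, ∫ x : Fin n → ℝ, g j (x j) ^ 2 ∂(Measure.pi ρ) ≤ V := fun j => by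
        rw [integral_comp_eval (μ := ρ) (i := j) (f := fun y => g j y ^ 2) (hg j).integrable_sq.aestronglyMeasurable]
        exact hV j
      refine (Finset.sum_le_sum fun j _ => this j).trans ?_
      simp
    have hs' : (0 : ℝ) ≤ s := Nat.cast_nonneg _
    nlinarith [mul_le_mul_of_nonneg_left b2 hs']

end ProductSums

/-- The moving sums over blocks of length `m` are `o(m)` in `L²`, uniformly in the position. -/
lemma eventually_maximal_block (C : ℕ) {V ε : ℝ} (hV0 : 0 ≤ V) (hε : 0 < ε) :
    ∀ᶠ m : ℕ in atTop, ∀ n : ℕ, n ≤ C * m → ∀ ρ : Fin n → Measure ℝ,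
      (∀ j, IsProbabilityMeasure (ρ j)) → ∀ g : Fin n → ℝ → ℝ, (∀ j, MemLp (g j) 2 (ρ j)) →
      (∀ j, ∫ y, g j y ∂(ρ j) = 0) → (∀ j, ∫ y, g j y ^ 2 ∂(ρ j) ≤ V) →
      ∃ M : (Fin n → ℝ) → ℝ, Integrable M (Measure.pi ρ) ∧
        (∀ x l, l + m ≤ n → (∑ j ∈ block m l, g j (x j)) ^ 2 ≤ M x) ∧
        ∫ x, M x ∂(Measure.pi ρ) ≤ ε * (m : ℝ) ^ 2 := by
  -- The mesh `s` is fixed first, making the quadratic term `8C²V m² / s` at most `ε m² / 2`; what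
  -- remains is linear in `m` and is absorbed for `m ≥ N`.
  obtain ⟨s, hs⟩ := exists_nat_gt (16 * C ^ 2 * V / ε)
  have hs0 : 0 < s := by
    have : (0 : ℝ) ≤ 16 * C ^ 2 * V / ε := by positivity
    exact_mod_cast this.trans_lt hs
  have hsr : (0 : ℝ) < s := by exact_mod_cast hs0
  obtain ⟨N, hN⟩ := exists_nat_gt (16 * C * V * (1 + s) / ε)
  filter_upwards [eventually_ge_atTop N] with m hm n hn ρ hρ g hg h0 hV
  obtain ⟨M, hM, hMb, hMi⟩ := exists_maximal_block hg h0 hV m hs0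
  refine ⟨M, hM, hMb, hMi.trans ?_⟩
  have hnr : (n : ℝ) ≤ C * m := by exact_mod_cast hn
  have hdiv : ((n / s : ℕ) : ℝ) ≤ C * m / s :=
    Nat.cast_div_le.trans (div_le_div_of_nonneg_right hnr hsr.le)
  have hmr : 16 * C * V * (1 + s) ≤ ε * m := by
    rw [div_lt_iff₀ hε] at hN
    have : (N : ℝ) ≤ m := by exact_mod_cast hm
    nlinarith
  rw [div_lt_iff₀ hε] at hs
  have hm0 : (0 : ℝ) ≤ m := Nat.cast_nonneg m
  calc 8 * (n * V) * (((n / s : ℕ) : ℝ) + 1 + s)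
      ≤ 8 * (C * m * V) * (C * m / s + 1 + s) := by gcongr
    _ = (16 * C ^ 2 * V) / s * m ^ 2 / 2 + 16 * C * V * (1 + s) * m / 2 := by
        field_simp; ring
    _ ≤ ε * m ^ 2 / 2 + ε * m * m / 2 := by
        have : (16 * C ^ 2 * V) / s ≤ ε := by
          rw [div_le_iff₀ hsr]; linarith
        gcongr
    _ = ε * (m : ℝ) ^ 2 := by ring

/-! ### Uniform `L¹` approximation of block variances. -/

/-- Decomposition of the error of a block variance: `M₁` bounds the squared moving sums of the
truncated centred squares, `W` the sum of the tails, and `M₂` the squared moving sums of the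
centred data. -/
lemma abs_blockVar_sub_le {n m : ℕ} (hm : 2 ≤ m) (μ : ℝ) (x : Fin n → ℝ) (l : Fin (n - m + 1))
    (hmn : m < n) {w g h t : Fin n → ℝ} {V δ η M₁ M₂ : ℝ} (hη : 0 < η)
    (hw0 : ∀ j, 0 ≤ w j) (hwV : ∀ j, w j ≤ V) (hh : ∀ j, 0 ≤ h j) (ht0 : ∀ j, 0 ≤ t j)
    (htδ : ∀ j, t j ≤ δ) (hdec : ∀ j, (x j - μ) ^ 2 - w j = g j + h j - t j)
    (h₁ : (∑ j ∈ block m l, g j) ^ 2 ≤ M₁) (h₂ : (∑ j ∈ block m l, (x j - μ)) ^ 2 ≤ M₂) :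
    |blockVar m x l - (∑ j ∈ block m l, w j) / m| ≤
      2 / m * (M₁ / (η * m) + η * m + ∑ j, h j + n * δ + V + M₂ / m) := by
  have hl : (l : ℕ) + m ≤ n := by have := l.2; omega
  have hm' : (2 : ℝ) ≤ m := by exact_mod_cast hm
  have hm0 : (0 : ℝ) < m := by linarith
  have hcard : ((block m l : Finset (Fin n)).card : ℝ) = m := by exact_mod_cast card_block hl
  set G := ∑ j ∈ block m l, g j with hG
  set H := ∑ j ∈ block m l, h j with hH
  set T := ∑ j ∈ block m l, t j with hT
  set W := ∑ j ∈ block m l, w j with hW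
  set Y := ∑ j ∈ block m l, (x j - μ) with hY
  have hY' : Y = ∑ j ∈ block m l, x j - m * μ := by
    rw [hY, Finset.sum_sub_distrib, Finset.sum_const, nsmul_eq_mul, hcard]
  have hmean : blockMean m x l = μ + Y / m := by
    rw [blockMean, hY']; field_simp; ring
  have hQ : ∑ j ∈ block m l, (x j - μ) ^ 2 = W + G + H - T := by
    rw [hW, hG, hH, hT, ← Finset.sum_add_distrib, ← Finset.sum_add_distrib,
      ← Finset.sum_sub_distrib]
    exact Finset.sum_congr rfl fun j _ => by linarith [hdec j]
  have hss : ∑ j ∈ block m l, (x j - blockMean m x l) ^ 2 = W + G + H - T - Y ^ 2 / m := by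
    have e : ∀ j : Fin n, (x j - blockMean m x l) ^ 2
        = (x j - μ) ^ 2 - 2 * (Y / m) * (x j - μ) + (Y / m) ^ 2 := fun j => by rw [hmean]; ring
    rw [Finset.sum_congr rfl fun j _ => e j, Finset.sum_add_distrib, Finset.sum_sub_distrib,
      ← Finset.mul_sum, ← hY, hQ, Finset.sum_const, nsmul_eq_mul, hcard]
    field_simp
    ring
  have hm1 : (0 : ℝ) < m - 1 := by linarith
  -- The extra `W / m` is the effect of dividing by `m - 1` instead of `m`.
  have hid : blockVar m x l - W / m = (G + H - T + W / m - Y ^ 2 / m) / (m - 1) := by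
    rw [blockVar, hss]
    field_simp
    ring
  have hG' : |G| ≤ M₁ / (η * m) + η * m := by
    have hc : 0 < η * m := by positivity
    have : G ^ 2 / (η * m) ≤ M₁ / (η * m) := div_le_div_of_nonneg_right h₁ hc.le
    -- Arithmetic-geometric mean inequality: it turns a bound on the square into one on `|G|`
    -- without taking the root of a random bound.
    have h3 : |G| ≤ G ^ 2 / (η * m) + η * m := by
      rw [div_add' _ _ _ hc.ne', le_div_iff₀ hc, ← sq_abs G]
      nlinarith [sq_nonneg (|G| - η * m), abs_nonneg G]
    linarith
  have hH0 : 0 ≤ H := Finset.sum_nonneg fun j _ => hh j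
  have hH' : H ≤ ∑ j, h j := Finset.sum_le_univ_sum_of_nonneg hh
  have hT0 : 0 ≤ T := Finset.sum_nonneg fun j _ => ht0 j
  have hT' : T ≤ n * δ := by
    refine (Finset.sum_le_univ_sum_of_nonneg ht0).trans ?_
    exact (Finset.sum_le_sum fun j _ => htδ j).trans (by simp)
  have hW0 : 0 ≤ W / m := div_nonneg (Finset.sum_nonneg fun j _ => hw0 j) hm0.le
  have hW' : W / m ≤ V := by
    rw [div_le_iff₀ hm0]
    refine (Finset.sum_le_sum fun j _ => hwV j).trans ?_
    rw [Finset.sum_const, nsmul_eq_mul, hcard, mul_comm]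
  have hY0 : 0 ≤ Y ^ 2 / m := by positivity
  have hY2 : Y ^ 2 / m ≤ M₂ / m := div_le_div_of_nonneg_right h₂ hm0.le
  rw [hid, abs_div, abs_of_pos hm1]
  set B := M₁ / (η * m) + η * m + ∑ j, h j + n * δ + V + M₂ / m with hB
  have hnum : |G + H - T + W / m - Y ^ 2 / m| ≤ B := by
    have := abs_le.1 hG'
    rw [abs_le]
    constructor <;> linarith
  have hB0 : 0 ≤ B := (abs_nonneg _).trans hnum
  rw [div_le_iff₀ hm1]
  refine hnum.trans ?_
  have : 1 ≤ 2 / (m : ℝ) * (m - 1) := by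
    rw [div_mul_eq_mul_div, le_div_iff₀ hm0]; linarith
  nlinarith

/-- Truncation of the squared deviation from `μ` at the level `L`. -/
def sqTail (μ L : ℝ) (y : ℝ) : ℝ := {y : ℝ | L ≤ |y - μ|}.indicator (fun y => (y - μ) ^ 2) y

lemma sqTail_nonneg (μ L y : ℝ) : 0 ≤ sqTail μ L y :=
  Set.indicator_nonneg (fun _ _ => sq_nonneg _) y

lemma measurableSet_tail (μ L : ℝ) : MeasurableSet {y : ℝ | L ≤ |y - μ|} :=
  measurableSet_le measurable_const (by fun_prop)

lemma measurable_sqTail (μ L : ℝ) : Measurable (sqTail μ L) :=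
  Measurable.indicator (by fun_prop) (measurableSet_tail μ L)

lemma integral_sqTail (μ L : ℝ) (ρ : Measure ℝ) :
    ∫ y, sqTail μ L y ∂ρ = ∫ y in {y : ℝ | L ≤ |y - μ|}, (y - μ) ^ 2 ∂ρ :=
  integral_indicator (measurableSet_tail μ L)

lemma sq_sub_sqTail_mem (μ L y : ℝ) : (y - μ) ^ 2 - sqTail μ L y ∈ Set.Icc 0 (L ^ 2) := by
  by_cases hy : L ≤ |y - μ|
  · simp [sqTail, hy, sq_nonneg]
  · rw [sqTail, Set.indicator_of_notMem (by simpa using hy), sub_zero, ← sq_abs (y - μ)]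
    push Not at hy
    exact ⟨sq_nonneg _, pow_le_pow_left₀ (abs_nonneg _) hy.le 2⟩

/-- Uniformly over all families of independent observations with mean `μ`, variances at most `V`
and uniformly integrable squares, the block variances are close in `L¹` to the averages of
the variances over the blocks, simultaneously for all blocks. -/
theorem eventually_blockVar_close (𝓡 : Set (Measure ℝ)) (μ V : ℝ) (hV0 : 0 ≤ V)
    (hprob : ∀ ρ ∈ 𝓡, IsProbabilityMeasure ρ)
    (hmem : ∀ ρ ∈ 𝓡, MemLp (fun y : ℝ => y - μ) 2 ρ)
    (hmean : ∀ ρ ∈ 𝓡, ∫ y, (y - μ) ∂ρ = 0)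
    (hvar : ∀ ρ ∈ 𝓡, ∫ y, (y - μ) ^ 2 ∂ρ ≤ V)
    (hui : ∀ δ > 0, ∃ L : ℝ, ∀ ρ ∈ 𝓡, ∫ y in {y : ℝ | L ≤ |y - μ|}, (y - μ) ^ 2 ∂ρ ≤ δ)
    (C : ℕ) {ε : ℝ} (hε : 0 < ε) :
    ∀ᶠ m : ℕ in atTop, ∀ n : ℕ, m < n → n ≤ C * m → ∀ ρ : Fin n → Measure ℝ, (∀ j, ρ j ∈ 𝓡) →
      ∃ R : (Fin n → ℝ) → ℝ, Integrable R (Measure.pi ρ) ∧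
        (∀ x l, |blockVar m x l - (∑ j ∈ block m l, ∫ y, (y - μ) ^ 2 ∂(ρ j)) / m| ≤ R x) ∧
        ∫ x, R x ∂(Measure.pi ρ) ≤ ε := by
  -- The bracket in `abs_blockVar_sub_le` will have mean at most `5 * η * m`, and its prefactor is
  -- `2 / m`.
  set η := ε / 10 with hηdef
  have hη : 0 < η := by positivity
  -- Chosen so that `2 * n * δ ≤ η * m`, for the random tails and their means together; the `+ 1`
  -- covers `C = 0`.
  set δ := η / (2 * C + 1) with hδdef
  have hδ : 0 < δ := by positivity
  obtain ⟨L, hL⟩ := hui δ hδ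
  obtain ⟨N, hN⟩ := exists_nat_gt (V / η)
  filter_upwards [eventually_maximal_block C (V := L ^ 4) (ε := η ^ 2) (by positivity)
    (by positivity), eventually_maximal_block C hV0 hη, eventually_ge_atTop N,
    eventually_ge_atTop 2] with m h₁ h₂ hNm hm n hmn hn ρ hρ
  have hpr : ∀ j, IsProbabilityMeasure (ρ j) := fun j => hprob _ (hρ j)
  have hsq : ∀ j, Integrable (fun y : ℝ => (y - μ) ^ 2) (ρ j) := fun j =>
    (hmem _ (hρ j)).integrable_sq
  have htail : ∀ j, Integrable (sqTail μ L) (ρ j) := fun j =>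
    (hsq j).indicator (measurableSet_tail μ L)
  set t : Fin n → ℝ := fun j => ∫ y, sqTail μ L y ∂(ρ j) with ht
  set w : Fin n → ℝ := fun j => ∫ y, (y - μ) ^ 2 ∂(ρ j) with hw
  have htδ : ∀ j, t j ≤ δ := fun j => by
    rw [ht]; simp only [integral_sqTail]; exact hL _ (hρ j)
  -- The truncated squares, centred. They are bounded by `L ^ 2`, so they have second moments at
  -- most `L ^ 4` although the data need not have fourth moments.
  set g : Fin n → ℝ → ℝ := fun j y => ((y - μ) ^ 2 - sqTail μ L y) - (w j - t j) with hgdef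
  have hdiff : ∀ j, Integrable (fun y : ℝ => (y - μ) ^ 2 - sqTail μ L y) (ρ j) := fun j =>
    (hsq j).sub (htail j)
  have hwt : ∀ j, ∫ y, ((y - μ) ^ 2 - sqTail μ L y) ∂(ρ j) = w j - t j := fun j =>
    integral_sub (hsq j) (htail j)
  have hwtI : ∀ j, w j - t j ∈ Set.Icc 0 (L ^ 2) := by
    intro j
    rw [← hwt j]
    refine ⟨integral_nonneg fun y => (sq_sub_sqTail_mem μ L y).1, ?_⟩
    refine (integral_mono (hdiff j) (integrable_const (L ^ 2))
      fun y => (sq_sub_sqTail_mem μ L y).2).trans ?_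
    simp
  have hgb : ∀ j y, |g j y| ≤ L ^ 2 := by
    intro j y
    have a := sq_sub_sqTail_mem μ L y
    have b := hwtI j
    rw [hgdef, abs_le]
    constructor <;> simp only <;> linarith [a.1, a.2, b.1, b.2]
  have hgm : ∀ j, MemLp (g j) 2 (ρ j) := fun j =>
    MemLp.of_bound (((hdiff j).sub (integrable_const _)).aestronglyMeasurable) (L ^ 2)
      (ae_of_all _ fun y => hgb j y)
  have hg0 : ∀ j, ∫ y, g j y ∂(ρ j) = 0 := by
    intro j
    rw [hgdef]
    simp only
    rw [integral_sub (hdiff j) (integrable_const _), hwt]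
    simp
  have hgV : ∀ j, ∫ y, g j y ^ 2 ∂(ρ j) ≤ L ^ 4 := by
    intro j
    refine (integral_mono (hgm j).integrable_sq (integrable_const (L ^ 4)) fun y => ?_).trans
      (by simp)
    have := pow_le_pow_left₀ (abs_nonneg _) (hgb j y) 2
    rw [sq_abs] at this
    calc g j y ^ 2 ≤ (L ^ 2) ^ 2 := this
      _ = L ^ 4 := by ring
  obtain ⟨M₁, hM₁, hb₁, hi₁⟩ := h₁ n hn ρ hpr g hgm hg0 hgV
  obtain ⟨M₂, hM₂, hb₂, hi₂⟩ := h₂ n hn ρ hpr (fun _ y => y - μ) (fun j => hmem _ (hρ j))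
    (fun j => hmean _ (hρ j)) (fun j => hvar _ (hρ j))
  have hm' : (2 : ℝ) ≤ m := by exact_mod_cast hm
  have hm0 : (0 : ℝ) < m := by linarith
  have hti : ∀ j, Integrable (fun x : Fin n → ℝ => sqTail μ L (x j)) (Measure.pi ρ) := fun j =>
    integrable_comp_eval (μ := ρ) (i := j) (htail j)
  have hW : Integrable (fun x : Fin n → ℝ => ∑ j, sqTail μ L (x j)) (Measure.pi ρ) :=
    integrable_finsetSum _ fun j _ => hti j
  have hWi : ∫ x : Fin n → ℝ, ∑ j, sqTail μ L (x j) ∂(Measure.pi ρ) ≤ n * δ := by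
    rw [integral_finsetSum _ fun j _ => hti j]
    have : ∀ j, ∫ x : Fin n → ℝ, sqTail μ L (x j) ∂(Measure.pi ρ) ≤ δ := fun j => by
      rw [integral_comp_eval (htail j).aestronglyMeasurable]
      exact htδ j
    exact (Finset.sum_le_sum fun j _ => this j).trans (by simp)
  have hi1 := hM₁.div_const (η * m)
  have hi2 := hi1.add (integrable_const (η * (m : ℝ)))
  have hi3 := hi2.add hW
  have hi4 := hi3.add (integrable_const (n * δ))
  have hi5 := hi4.add (integrable_const V)
  have hi6 := hi5.add (hM₂.div_const (m : ℝ))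
  refine ⟨fun x => 2 / m * (M₁ x / (η * m) + η * m + ∑ j, sqTail μ L (x j) + n * δ + V +
    M₂ x / m), hi6.const_mul _, ?_, ?_⟩
  · intro x l
    have hl : (l : ℕ) + m ≤ n := by have := l.2; omega
    exact abs_blockVar_sub_le hm μ x l hmn (g := fun j => g j (x j)) (t := t) hη
      (fun j => integral_nonneg fun y => sq_nonneg _) (fun j => hvar _ (hρ j))
      (fun j => sqTail_nonneg _ _ _) (fun j => integral_nonneg fun y => sqTail_nonneg _ _ _) htδ
      (fun j => by simp only [hgdef]; ring) (hb₁ x l hl) (hb₂ x l hl)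
  · rw [integral_const_mul]
    have key : ∫ x : Fin n → ℝ, (M₁ x / (η * m) + η * m + ∑ j, sqTail μ L (x j) + n * δ + V +
        M₂ x / m) ∂(Measure.pi ρ) = (∫ x, M₁ x ∂(Measure.pi ρ)) / (η * m) + η * m +
        ∫ x : Fin n → ℝ, ∑ j, sqTail μ L (x j) ∂(Measure.pi ρ) + n * δ + V +
        (∫ x, M₂ x ∂(Measure.pi ρ)) / m := by
      erw [integral_add hi5 (hM₂.div_const (m : ℝ)), integral_add hi4 (integrable_const V),
        integral_add hi3 (integrable_const (n * δ)), integral_add hi2 hW,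
        integral_add hi1 (integrable_const (η * (m : ℝ)))]
      simp [integral_div]
    rw [key]
    have e1 : (∫ x, M₁ x ∂(Measure.pi ρ)) / (η * m) ≤ η * m := by
      rw [div_le_iff₀ (by positivity)]
      calc _ ≤ η ^ 2 * (m : ℝ) ^ 2 := hi₁
        _ = _ := by ring
    have e2 : (∫ x, M₂ x ∂(Measure.pi ρ)) / m ≤ η * m := by
      rw [div_le_iff₀ (by positivity)]
      calc _ ≤ η * (m : ℝ) ^ 2 := hi₂
        _ = _ := by ring
    have e3 : V ≤ η * m := by
      rw [div_lt_iff₀ hη] at hN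
      have : (N : ℝ) ≤ m := by exact_mod_cast hNm
      nlinarith
    have e4 : 2 * (n * δ) ≤ η * m := by
      have hnr : (n : ℝ) ≤ C * m := by exact_mod_cast hn
      have : (2 * C + 1) * δ = η := by rw [hδdef]; field_simp
      nlinarith
    rw [div_mul_eq_mul_div, div_le_iff₀ hm0]
    have : η * m * 10 = ε * m := by rw [hηdef]; ring
    linarith

/-! ### Maximum and minimum as Lipschitz functions. -/

section Extrema

variable {ι : Type*} [Fintype ι] [Nonempty ι] {a b : ι → ℝ} {r : ℝ}

lemma abs_sup'_sub_sup'_le (h : ∀ i, |a i - b i| ≤ r) :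
    |Finset.univ.sup' Finset.univ_nonempty a - Finset.univ.sup' Finset.univ_nonempty b| ≤ r := by
  have hab : ∀ i, a i ≤ Finset.univ.sup' Finset.univ_nonempty b + r := fun i => by
    have h1 := Finset.le_sup' b (Finset.mem_univ i)
    have h2 := abs_le.1 (h i)
    linarith
  have hba : ∀ i, b i ≤ Finset.univ.sup' Finset.univ_nonempty a + r := fun i => by
    have h1 := Finset.le_sup' a (Finset.mem_univ i)
    have h2 := abs_le.1 (h i)
    linarith
  have h1 := Finset.sup'_le Finset.univ_nonempty a fun i _ => hab i
  have h2 := Finset.sup'_le Finset.univ_nonempty b fun i _ => hba i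
  rw [abs_le]
  constructor <;> linarith

lemma abs_inf'_sub_inf'_le (h : ∀ i, |a i - b i| ≤ r) :
    |Finset.univ.inf' Finset.univ_nonempty a - Finset.univ.inf' Finset.univ_nonempty b| ≤ r := by
  have hab : ∀ i, Finset.univ.inf' Finset.univ_nonempty b - r ≤ a i := fun i => by
    have h1 := Finset.inf'_le b (Finset.mem_univ i)
    have h2 := abs_le.1 (h i)
    linarith
  have hba : ∀ i, Finset.univ.inf' Finset.univ_nonempty a - r ≤ b i := fun i => by
    have h1 := Finset.inf'_le a (Finset.mem_univ i)
    have h2 := abs_le.1 (h i)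
    linarith
  have h1 := Finset.le_inf' Finset.univ_nonempty a fun i _ => hab i
  have h2 := Finset.le_inf' Finset.univ_nonempty b fun i _ => hba i
  rw [abs_le]
  constructor <;> linarith

lemma lipschitzWith_sup' :
    LipschitzWith 1 fun v : ι → ℝ => Finset.univ.sup' Finset.univ_nonempty v :=
  LipschitzWith.of_dist_le_mul fun v w => by
    rw [NNReal.coe_one, one_mul, Real.dist_eq]
    exact abs_sup'_sub_sup'_le fun i => by
      simpa [Real.dist_eq] using dist_le_pi_dist v w i

lemma lipschitzWith_inf' :
    LipschitzWith 1 fun v : ι → ℝ => Finset.univ.inf' Finset.univ_nonempty v :=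
  LipschitzWith.of_dist_le_mul fun v w => by
    rw [NNReal.coe_one, one_mul, Real.dist_eq]
    exact abs_inf'_sub_inf'_le fun i => by
      simpa [Real.dist_eq] using dist_le_pi_dist v w i

end Extrema

lemma continuous_blockVar {n : ℕ} (m : ℕ) : Continuous (blockVar m : (Fin n → ℝ) → _) := by
  unfold blockVar blockMean
  fun_prop

/-! ### Block averages of the true variances, and special configurations. -/

namespace Config

variable {Ξ : Set (Measure ℝ)} {σl σu : ℝ} {n m : ℕ} (θ : Config Ξ σl σu n m)

/-- The average variance of the observations in the `l`-th moving block. -/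
def blockAvg (l : Fin (n - m + 1)) : ℝ :=
  (∑ j ∈ block m l, θ.sd (θ.parts.index j) ^ 2) / m

lemma le_maxVar (i) : θ.sd i ^ 2 ≤ θ.maxVar :=
  le_ciSup (f := fun i => θ.sd i ^ 2) (Set.finite_range _).bddAbove i

lemma minVar_le (i) : θ.minVar ≤ θ.sd i ^ 2 :=
  ciInf_le (f := fun i => θ.sd i ^ 2) (Set.finite_range _).bddBelow i

lemma sd_sq_le (hσ : 0 ≤ σl) (i) : θ.sd i ^ 2 ≤ σu ^ 2 :=
  pow_le_pow_left₀ (hσ.trans (θ.sd_mem i).1) (θ.sd_mem i).2 2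

lemma le_sd_sq (hσ : 0 ≤ σl) (i) : σl ^ 2 ≤ θ.sd i ^ 2 := pow_le_pow_left₀ hσ (θ.sd_mem i).1 2

lemma nonempty_parts (hn : 0 < n) : Nonempty (Fin θ.parts.length) :=
  ⟨⟨0, θ.parts.length_pos_iff.2 hn⟩⟩

lemma exists_sd_sq_eq_maxVar (hn : 0 < n) : ∃ i, θ.sd i ^ 2 = θ.maxVar :=
  haveI := θ.nonempty_parts hn
  exists_eq_ciSup_of_finite

lemma exists_sd_sq_eq_minVar (hn : 0 < n) : ∃ i, θ.sd i ^ 2 = θ.minVar :=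
  haveI := θ.nonempty_parts hn
  exists_eq_ciInf_of_finite

lemma card_block_fin (hmn : m < n) (l : Fin (n - m + 1)) :
    ((block m l : Finset (Fin n)).card : ℝ) = m := by
  have := l.2
  exact_mod_cast card_block (n := n) (m := m) (l := l) (by omega)

lemma blockAvg_le_maxVar (hm : 0 < m) (hmn : m < n) (l) : θ.blockAvg l ≤ θ.maxVar := by
  rw [blockAvg, div_le_iff₀ (by exact_mod_cast hm)]
  refine (Finset.sum_le_sum fun j _ => θ.le_maxVar _).trans ?_
  rw [Finset.sum_const, nsmul_eq_mul, card_block_fin hmn, mul_comm]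

lemma minVar_le_blockAvg (hm : 0 < m) (hmn : m < n) (l) : θ.minVar ≤ θ.blockAvg l := by
  rw [blockAvg, le_div_iff₀ (by exact_mod_cast hm)]
  refine le_trans ?_ (Finset.sum_le_sum fun j _ => θ.minVar_le _)
  rw [Finset.sum_const, nsmul_eq_mul, card_block_fin hmn, mul_comm]

/-- Every sub-sample contains a whole moving block. -/
lemma exists_blockAvg_eq (hm : 0 < m) (hmn : m < n) (i) : ∃ l, θ.blockAvg l = θ.sd i ^ 2 := by
  have h1 := θ.parts.sizeUpTo_succ' i
  have h2 := θ.parts.sizeUpTo_le (i + 1)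
  have h3 := θ.long i
  have hl : θ.parts.sizeUpTo i < n - m + 1 := by omega
  refine ⟨⟨θ.parts.sizeUpTo i, hl⟩, ?_⟩
  have hidx : ∀ j ∈ (block m (θ.parts.sizeUpTo i) : Finset (Fin n)), θ.parts.index j = i := by
    intro j hj
    simp only [block, Finset.mem_filter, Finset.mem_univ, true_and] at hj
    refine (θ.parts.mem_range_embedding_iff'.1 (θ.parts.mem_range_embedding_iff.2 ⟨hj.1, ?_⟩)).symm
    simp only [Nat.succ_eq_add_one]
    omega
  have hm0 : (m : ℝ) ≠ 0 := by exact_mod_cast hm.ne'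
  rw [blockAvg, Finset.sum_congr rfl fun j hj => by rw [hidx j hj], Finset.sum_const, nsmul_eq_mul,
    card_block_fin hmn ⟨θ.parts.sizeUpTo i, hl⟩]
  field_simp

/-- The maximum is attained at a block lying inside a sub-sample of maximal variance. -/
lemma sup'_blockAvg (hm : 0 < m) (hmn : m < n) :
    Finset.univ.sup' Finset.univ_nonempty θ.blockAvg = θ.maxVar := by
  refine le_antisymm (Finset.sup'_le _ _ fun l _ => θ.blockAvg_le_maxVar hm hmn l) ?_
  obtain ⟨i, hi⟩ := θ.exists_sd_sq_eq_maxVar (by omega)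
  obtain ⟨l, hl⟩ := θ.exists_blockAvg_eq hm hmn i
  rw [← hi, ← hl]
  exact Finset.le_sup' _ (Finset.mem_univ l)

lemma inf'_blockAvg (hm : 0 < m) (hmn : m < n) :
    Finset.univ.inf' Finset.univ_nonempty θ.blockAvg = θ.minVar := by
  refine le_antisymm ?_ (Finset.le_inf' _ _ fun l _ => θ.minVar_le_blockAvg hm hmn l)
  obtain ⟨i, hi⟩ := θ.exists_sd_sq_eq_minVar (by omega)
  obtain ⟨l, hl⟩ := θ.exists_blockAvg_eq hm hmn i
  rw [← hi, ← hl]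
  exact Finset.inf'_le _ (Finset.mem_univ l)

/-- The same configuration with other bounds for the standard deviations. -/
def withBounds {σl' σu' : ℝ} (h : ∀ i, θ.sd i ∈ Set.Icc σl' σu') : Config Ξ σl' σu' n m :=
  { θ with sd_mem := h }

lemma law_withBounds {σl' σu' : ℝ} (h : ∀ i, θ.sd i ∈ Set.Icc σl' σu') (μ : ℝ) :
    (θ.withBounds h).law μ = θ.law μ := rfl

/-- The configuration with a single sub-sample. -/
def single {ν : Measure ℝ} (hν : ν ∈ Ξ) {σ : ℝ} (hσ : σ ∈ Set.Icc σl σu) (hmn : m < n) :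
    Config Ξ σl σu n m where
  parts := Composition.single n (Nat.zero_lt_of_lt hmn)
  long i := by simpa using hmn
  sd _ := σ
  sd_mem _ := hσ
  noise _ := ν
  noise_mem _ := hν

lemma maxVar_single {ν : Measure ℝ} (hν : ν ∈ Ξ) {σ : ℝ} (hσ : σ ∈ Set.Icc σl σu) (hmn : m < n) :
    (single hν hσ hmn).maxVar = σ ^ 2 := by
  obtain ⟨i, hi⟩ := (single hν hσ hmn).exists_sd_sq_eq_maxVar (Nat.zero_lt_of_lt hmn)
  exact hi.symm

lemma minVar_single {ν : Measure ℝ} (hν : ν ∈ Ξ) {σ : ℝ} (hσ : σ ∈ Set.Icc σl σu) (hmn : m < n) :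
    (single hν hσ hmn).minVar = σ ^ 2 := by
  obtain ⟨i, hi⟩ := (single hν hσ hmn).exists_sd_sq_eq_minVar (Nat.zero_lt_of_lt hmn)
  exact hi.symm

lemma isProbabilityMeasure_law (hΞ : IsNoiseClass Ξ) (μ : ℝ) :
    IsProbabilityMeasure (θ.law μ) := by
  have : ∀ j, IsProbabilityMeasure ((θ.noise (θ.parts.index j)).map
      fun e : ℝ => μ + θ.sd (θ.parts.index j) * e) := fun j =>
    haveI := hΞ.prob _ (θ.noise_mem (θ.parts.index j))
    Measure.isProbabilityMeasure_map (by fun_prop)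
  rw [law]
  infer_instance

end Config

/-! ### Moments and tails of the observations. -/

/-- The law of `μ + σ ε`, with `ε` of law `ν`. -/
def affineLaw (ν : Measure ℝ) (μ σ : ℝ) : Measure ℝ := ν.map fun e : ℝ => μ + σ * e

section AffineLaw

variable {Ξ : Set (Measure ℝ)} {ν : Measure ℝ}

lemma integral_affineLaw (ν : Measure ℝ) (μ σ : ℝ) {f : ℝ → ℝ} (hf : Measurable f) :
    ∫ y, f y ∂(affineLaw ν μ σ) = ∫ e, f (μ + σ * e) ∂ν :=
  integral_map (by fun_prop) hf.aestronglyMeasurable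

lemma integral_sq_affineLaw (hΞ : IsNoiseClass Ξ) (hν : ν ∈ Ξ) (μ σ : ℝ) :
    ∫ y, (y - μ) ^ 2 ∂(affineLaw ν μ σ) = σ ^ 2 := by
  rw [integral_affineLaw ν μ σ (by fun_prop)]
  simp only [add_sub_cancel_left, mul_pow]
  rw [integral_const_mul, hΞ.var_one ν hν, mul_one]

lemma integral_sub_affineLaw (hΞ : IsNoiseClass Ξ) (hν : ν ∈ Ξ) (μ σ : ℝ) :
    ∫ y, (y - μ) ∂(affineLaw ν μ σ) = 0 := by
  rw [integral_affineLaw ν μ σ (by fun_prop)]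
  simp only [add_sub_cancel_left]
  rw [integral_const_mul, hΞ.mean_zero ν hν, mul_zero]

lemma memLp_affineLaw (hΞ : IsNoiseClass Ξ) (hν : ν ∈ Ξ) (μ σ : ℝ) :
    MemLp (fun y : ℝ => y - μ) 2 (affineLaw ν μ σ) := by
  rw [affineLaw, memLp_map_measure_iff (by fun_prop) (by fun_prop)]
  have := (hΞ.memLp ν hν).const_mul σ
  convert this using 1
  ext e
  simp

/-- If `σ ≤ B`, then `|σ e| ≥ B * K` forces `|e| ≥ K`. Thus uniform integrability over the noise
class passes to all scales up to `B` at once. -/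
lemma tail_affineLaw_le (hΞ : IsNoiseClass Ξ) (hν : ν ∈ Ξ) (μ : ℝ) {σ B K : ℝ} (hσ : 0 ≤ σ)
    (hσB : σ ≤ B) (hB : 0 < B) :
    ∫ y in {y : ℝ | B * K ≤ |y - μ|}, (y - μ) ^ 2 ∂(affineLaw ν μ σ) ≤
      B ^ 2 * ∫ e in {e : ℝ | K ≤ |e|}, e ^ 2 ∂ν := by
  have hint := (hΞ.memLp ν hν).integrable_sq
  have hK : MeasurableSet {e : ℝ | K ≤ |e|} := measurableSet_le measurable_const (by fun_prop)
  rw [← integral_sqTail, integral_affineLaw ν μ σ (measurable_sqTail _ _), ← integral_indicator hK,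
    ← integral_const_mul]
  refine integral_mono_of_nonneg (ae_of_all _ fun e => sqTail_nonneg _ _ _)
    ((hint.indicator hK).const_mul _) (ae_of_all _ fun e => ?_)
  have hle : σ * |e| ≤ B * |e| := mul_le_mul_of_nonneg_right hσB (abs_nonneg e)
  by_cases h : B * K ≤ |σ * e|
  · have hKe : K ≤ |e| := by
      rw [abs_mul, abs_of_nonneg hσ] at h
      exact le_of_mul_le_mul_left (h.trans hle) hB
    have h1 : sqTail μ (B * K) (μ + σ * e) = (σ * e) ^ 2 := by
      have hmem : μ + σ * e ∈ {y : ℝ | B * K ≤ |y - μ|} := by simpa using h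
      rw [sqTail, Set.indicator_of_mem hmem, add_sub_cancel_left]
    have h2 : {e : ℝ | K ≤ |e|}.indicator (fun e : ℝ => e ^ 2) e = e ^ 2 :=
      Set.indicator_of_mem (by simpa using hKe) _
    simp only [h1, h2, mul_pow]
    gcongr
  · have h1 : sqTail μ (B * K) (μ + σ * e) = 0 := by
      simp only [sqTail]
      exact Set.indicator_of_notMem (by simpa using h) _
    simp only [h1]
    exact mul_nonneg (sq_nonneg _) (Set.indicator_nonneg (fun _ _ => sq_nonneg _) e)

end AffineLaw

/-! ### Uniform closeness over configurations, and limits of the sublinear expectation. -/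

section Main

variable {Ξ : Set (Measure ℝ)} {n : ℕ → ℕ} {σl σu : ℝ}

/-- Uniformly over all configurations, the block variances are close in `L¹` to the block averages
of the true variances, simultaneously for all blocks. -/
theorem eventually_config_close (hΞ : IsNoiseClass Ξ) (μ : ℝ) (hmn : ∀ᶠ m in atTop, m < n m)
    (hratio : ∃ C : ℕ, ∀ᶠ m in atTop, n m ≤ C * m) (hσ : 0 ≤ σl) {ε : ℝ} (hε : 0 < ε) :
    ∀ᶠ m in atTop, ∀ θ : Config Ξ σl σu (n m) m,
      ∃ R : (Fin (n m) → ℝ) → ℝ, Integrable R (θ.law μ) ∧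
        (∀ x l, |blockVar m x l - θ.blockAvg l| ≤ R x) ∧ ∫ x, R x ∂(θ.law μ) ≤ ε := by
  obtain ⟨C, hC⟩ := hratio
  set 𝓡 : Set (Measure ℝ) := {ρ | ∃ ν ∈ Ξ, ∃ σ ∈ Set.Icc σl σu, ρ = affineLaw ν μ σ} with h𝓡
  have hsq : ∀ ρ ∈ 𝓡, ∫ y, (y - μ) ^ 2 ∂ρ ≤ σu ^ 2 := by
    rintro ρ ⟨ν, hν, σ, hσm, rfl⟩
    rw [integral_sq_affineLaw hΞ hν]
    exact pow_le_pow_left₀ (hσ.trans hσm.1) hσm.2 2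
  have hui : ∀ δ > 0, ∃ L : ℝ, ∀ ρ ∈ 𝓡,
      ∫ y in {y : ℝ | L ≤ |y - μ|}, (y - μ) ^ 2 ∂ρ ≤ δ := by
    intro δ hδ
    set B := |σu| + 1 with hB
    have hB0 : 0 < B := by positivity
    obtain ⟨K, hK⟩ := hΞ.unif_sq_integrable (δ / B ^ 2) (by positivity)
    refine ⟨B * K, ?_⟩
    rintro ρ ⟨ν, hν, σ, hσm, rfl⟩
    refine (tail_affineLaw_le hΞ hν μ (hσ.trans hσm.1)
      (hσm.2.trans ((le_abs_self σu).trans (by rw [hB]; linarith))) hB0).trans ?_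
    have := mul_le_mul_of_nonneg_left (hK ν hν) (sq_nonneg B)
    rwa [mul_div_cancel₀ _ (by positivity)] at this
  filter_upwards [hmn, hC, eventually_blockVar_close 𝓡 μ (σu ^ 2) (sq_nonneg _)
    (by
      rintro ρ ⟨ν, hν, σ, hσm, rfl⟩
      have := hΞ.prob ν hν
      exact Measure.isProbabilityMeasure_map (by fun_prop))
    (by rintro ρ ⟨ν, hν, σ, hσm, rfl⟩; exact memLp_affineLaw hΞ hν μ σ)
    (by rintro ρ ⟨ν, hν, σ, hσm, rfl⟩; exact integral_sub_affineLaw hΞ hν μ σ)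
    hsq hui C hε] with m h1 h2 h3 θ
  obtain ⟨R, hR, hb, hi⟩ := h3 (n m) h1 h2
    (fun j => affineLaw (θ.noise (θ.parts.index j)) μ (θ.sd (θ.parts.index j)))
    (fun j => ⟨_, θ.noise_mem _, _, θ.sd_mem _, rfl⟩)
  refine ⟨R, hR, fun x l => ?_, hi⟩
  have := hb x l
  simp only [integral_sq_affineLaw hΞ (θ.noise_mem _)] at this
  exact this

/-- A Lipschitz function of the block variances is close in `L¹` to its value at the block averages
of the true variances, uniformly over all configurations. -/
theorem eventually_lipschitz_close (hΞ : IsNoiseClass Ξ) (μ : ℝ) (hmn : ∀ᶠ m in atTop, m < n m)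
    (hratio : ∃ C : ℕ, ∀ᶠ m in atTop, n m ≤ C * m) (hσ : 0 ≤ σl) {K : NNReal}
    {f : ∀ m : ℕ, (Fin (n m - m + 1) → ℝ) → ℝ} (hf : ∀ m, LipschitzWith K (f m))
    {ε : ℝ} (hε : 0 < ε) :
    ∀ᶠ m in atTop, ∀ θ : Config Ξ σl σu (n m) m,
      Integrable (fun x => f m (blockVar m x)) (θ.law μ) ∧
      ∫ x, |f m (blockVar m x) - f m θ.blockAvg| ∂(θ.law μ) ≤ ε := by
  filter_upwards [eventually_config_close hΞ μ hmn hratio hσ (σu := σu)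
    -- The `+ 1` allows `K = 0`.
    (ε := ε / (K + 1)) (by positivity)] with m h θ
  obtain ⟨R, hR, hb, hi⟩ := h θ
  have := θ.isProbabilityMeasure_law hΞ μ
  have hd : ∀ x, |f m (blockVar m x) - f m θ.blockAvg| ≤ K * R x := by
    intro x
    rw [← Real.dist_eq]
    refine ((hf m).dist_le_mul _ _).trans (mul_le_mul_of_nonneg_left ?_ K.coe_nonneg)
    refine (dist_pi_le_iff ((abs_nonneg _).trans (hb x 0))).2 fun l => ?_
    rw [Real.dist_eq]
    exact hb x l
  have hR0 : 0 ≤ ∫ x, R x ∂(θ.law μ) :=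
    integral_nonneg fun x => (abs_nonneg _).trans (hb x 0)
  have hmeas : AEStronglyMeasurable (fun x => f m (blockVar m x)) (θ.law μ) :=
    ((hf m).continuous.comp (continuous_blockVar m)).aestronglyMeasurable
  have hdi : Integrable (fun x => f m (blockVar m x) - f m θ.blockAvg) (θ.law μ) :=
    (hR.const_mul (K : ℝ)).mono' (hmeas.sub aestronglyMeasurable_const)
      (ae_of_all _ fun x => hd x)
  refine ⟨?_, ?_⟩
  · have := hdi.add (integrable_const (f m θ.blockAvg))
    refine this.congr (ae_of_all _ fun x => ?_)
    simp
  · refine (integral_mono hdi.abs (hR.const_mul (K : ℝ)) hd).trans ?_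
    rw [integral_const_mul]
    have hK : (0 : ℝ) < K + 1 := by positivity
    rw [le_div_iff₀ hK] at hi
    nlinarith

/-- Unfolds the limit of suprema in `EReal` into the two real statements used below: a bound uniform
in the configuration, and one configuration that nearly attains it. -/
lemma tendsto_upperExp_iff {μ c : ℝ} {T : Statistic n} :
    Tendsto (fun m => upperExp Ξ μ σl σu (n m) m (T m)) atTop (𝓝 (c : EReal)) ↔
      ∀ ε > 0, ∀ᶠ m in atTop, (∀ θ : Config Ξ σl σu (n m) m, ∫ x, T m x ∂(θ.law μ) ≤ c + ε) ∧
        ∃ θ : Config Ξ σl σu (n m) m, c - ε ≤ ∫ x, T m x ∂(θ.law μ) := by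
  rw [tendsto_order]
  constructor
  · rintro ⟨h1, h2⟩ ε hε
    filter_upwards [h1 ((c - ε : ℝ) : EReal) (EReal.coe_lt_coe_iff.2 (by linarith)),
      h2 ((c + ε : ℝ) : EReal) (EReal.coe_lt_coe_iff.2 (by linarith))] with m h1 h2
    refine ⟨fun θ => ?_, ?_⟩
    · exact EReal.coe_le_coe_iff.1 ((le_iSup (fun θ : Config Ξ σl σu (n m) m =>
        ((∫ x, T m x ∂(θ.law μ) : ℝ) : EReal)) θ).trans h2.le)
    · obtain ⟨θ, hθ⟩ := lt_iSup_iff.1 h1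
      exact ⟨θ, (EReal.coe_lt_coe_iff.1 hθ).le⟩
  · intro h
    constructor
    · intro a ha
      obtain ⟨r, har, hrc⟩ := EReal.lt_iff_exists_real_btwn.1 ha
      rw [EReal.coe_lt_coe_iff] at hrc
      filter_upwards [h (c - r) (by linarith)] with m hm
      obtain ⟨θ, hθ⟩ := hm.2
      refine har.trans_le (le_iSup_of_le θ (EReal.coe_le_coe_iff.2 ?_))
      linarith
    · intro a ha
      obtain ⟨r, hcr, hra⟩ := EReal.lt_iff_exists_real_btwn.1 ha
      rw [EReal.coe_lt_coe_iff] at hcr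
      filter_upwards [h (r - c) (by linarith)] with m hm
      refine (iSup_le fun θ => EReal.coe_le_coe_iff.2 ?_).trans_lt hra
      linarith [hm.1 θ]

lemma tendsto_neg_upperExp_neg_iff {μ c : ℝ} {T : Statistic n} :
    Tendsto (fun m => -upperExp Ξ μ σl σu (n m) m (fun x => -T m x)) atTop (𝓝 (c : EReal)) ↔
      ∀ ε > 0, ∀ᶠ m in atTop, (∀ θ : Config Ξ σl σu (n m) m, c - ε ≤ ∫ x, T m x ∂(θ.law μ)) ∧
        ∃ θ : Config Ξ σl σu (n m) m, ∫ x, T m x ∂(θ.law μ) ≤ c + ε := by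
  have h1 : Tendsto (fun m => -upperExp Ξ μ σl σu (n m) m (fun x => -T m x)) atTop
      (𝓝 (c : EReal)) ↔ Tendsto (fun m => upperExp Ξ μ σl σu (n m) m (fun x => -T m x)) atTop
      (𝓝 ((-c : ℝ) : EReal)) := by
    constructor <;> intro h
    · simpa [Function.comp_def] using (continuous_neg.tendsto _).comp h
    · simpa [Function.comp_def] using (continuous_neg.tendsto _).comp h
  rw [h1, tendsto_upperExp_iff (T := fun m x => -T m x)]
  simp only [integral_neg]
  refine forall₂_congr fun ε _ => eventually_congr (Eventually.of_forall fun m => ?_)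
  refine and_congr (forall_congr' fun θ => ?_) (exists_congr fun θ => ?_)
  · constructor <;> intro h <;> linarith
  · constructor <;> intro h <;> linarith

end Main

lemma abs_integral_sub_const_le {Ω : Type*} [MeasurableSpace Ω] {P : Measure Ω}
    [IsProbabilityMeasure P] {X : Ω → ℝ} (hX : Integrable X P) (c : ℝ) :
    |∫ x, X x ∂P - c| ≤ ∫ x, |X x - c| ∂P := by
  have h := abs_integral_le_integral_abs (μ := P) (f := fun x => X x - c)
  rw [integral_sub hX (integrable_const c)] at h
  simpa using h

/-- If `X` and `Y` are close in mean to constants `a ≤ b + ε`, then `X ≤ Y` up to a small error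
in mean. -/
lemma integral_max_sub_le {Ω : Type*} [MeasurableSpace Ω] {P : Measure Ω}
    [IsProbabilityMeasure P] {X Y : Ω → ℝ} (hX : Integrable X P) (hY : Integrable Y P)
    {a b ε : ℝ} (hε : 0 ≤ ε) (hab : a ≤ b + ε) :
    ∫ x, max (X x - Y x) 0 ∂P ≤ ∫ x, |X x - a| ∂P + ∫ x, |Y x - b| ∂P + ε := by
  have hXi : Integrable (fun x => |X x - a|) P := (hX.sub (integrable_const a)).abs
  have hYi : Integrable (fun x => |Y x - b|) P := (hY.sub (integrable_const b)).abs
  have hXY : Integrable (fun x => |X x - a| + |Y x - b|) P := hXi.add hYi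
  have hmono : ∫ x, max (X x - Y x) 0 ∂P ≤ ∫ x, (|X x - a| + |Y x - b| + ε) ∂P := by
    refine integral_mono (hX.sub hY).pos_part (hXY.add (integrable_const ε)) fun x => ?_
    have h1 := le_abs_self (X x - a)
    have h2 := neg_abs_le (Y x - b)
    refine max_le ?_ ?_
    · simp only; linarith
    · positivity
  refine hmono.trans (le_of_eq ?_)
  rw [integral_add hXY (integrable_const ε), integral_add hXi hYi]
  simp

/-! ### Asymptotic unbiasedness of the moving-block estimators. -/

variable {Ξ : Set (Measure ℝ)} {n : ℕ → ℕ} {σl σu : ℝ}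

lemma isLipschitzBlockStatistic_mbMax (n : ℕ → ℕ) :
    IsLipschitzBlockStatistic n fun m x => mbMax m x :=
  ⟨1, fun _ v => Finset.univ.sup' Finset.univ_nonempty v, fun _ => lipschitzWith_sup',
    fun _ _ => rfl⟩

lemma isLipschitzBlockStatistic_mbMin (n : ℕ → ℕ) :
    IsLipschitzBlockStatistic n fun m x => mbMin m x :=
  ⟨1, fun _ v => Finset.univ.inf' Finset.univ_nonempty v, fun _ => lipschitzWith_inf',
    fun _ _ => rfl⟩

theorem eventually_mbMax_close (hΞ : IsNoiseClass Ξ) (μ : ℝ) (hmn : ∀ᶠ m in atTop, m < n m)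
    (hratio : ∃ C : ℕ, ∀ᶠ m in atTop, n m ≤ C * m) (hσ : 0 ≤ σl) {ε : ℝ} (hε : 0 < ε) :
    ∀ᶠ m in atTop, ∀ θ : Config Ξ σl σu (n m) m, Integrable (fun x => mbMax m x) (θ.law μ) ∧
      ∫ x, |mbMax m x - θ.maxVar| ∂(θ.law μ) ≤ ε := by
  filter_upwards [hmn, eventually_gt_atTop 0, eventually_lipschitz_close hΞ μ hmn hratio hσ
    (σu := σu) (f := fun _ v => Finset.univ.sup' Finset.univ_nonempty v)
    (fun _ => lipschitzWith_sup') hε] with m h1 h0 h2 θ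
  have h := h2 θ
  rw [θ.sup'_blockAvg h0 h1] at h
  exact h

theorem eventually_mbMin_close (hΞ : IsNoiseClass Ξ) (μ : ℝ) (hmn : ∀ᶠ m in atTop, m < n m)
    (hratio : ∃ C : ℕ, ∀ᶠ m in atTop, n m ≤ C * m) (hσ : 0 ≤ σl) {ε : ℝ} (hε : 0 < ε) :
    ∀ᶠ m in atTop, ∀ θ : Config Ξ σl σu (n m) m, Integrable (fun x => mbMin m x) (θ.law μ) ∧
      ∫ x, |mbMin m x - θ.minVar| ∂(θ.law μ) ≤ ε := by
  filter_upwards [hmn, eventually_gt_atTop 0, eventually_lipschitz_close hΞ μ hmn hratio hσ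
    (σu := σu) (f := fun _ v => Finset.univ.inf' Finset.univ_nonempty v)
    (fun _ => lipschitzWith_inf') hε] with m h1 h0 h2 θ
  have h := h2 θ
  rw [θ.inf'_blockAvg h0 h1] at h
  exact h

theorem asympUnbiasedAt_mbMax (hΞ : IsNoiseClass Ξ) (μ : ℝ) (hmn : ∀ᶠ m in atTop, m < n m)
    (hratio : ∃ C : ℕ, ∀ᶠ m in atTop, n m ≤ C * m) :
    AsympUnbiasedAt Ξ μ n (fun m x => mbMax m x) (fun θ => θ.maxVar) := by
  intro σl σu hσ _ ε hε
  filter_upwards [eventually_mbMax_close hΞ μ hmn hratio hσ (σu := σu) hε] with m h θ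
  have := θ.isProbabilityMeasure_law hΞ μ
  exact (abs_integral_sub_const_le (h θ).1 _).trans (h θ).2

theorem asympUnbiasedAt_mbMin (hΞ : IsNoiseClass Ξ) (μ : ℝ) (hmn : ∀ᶠ m in atTop, m < n m)
    (hratio : ∃ C : ℕ, ∀ᶠ m in atTop, n m ≤ C * m) :
    AsympUnbiasedAt Ξ μ n (fun m x => mbMin m x) (fun θ => θ.minVar) := by
  intro σl σu hσ _ ε hε
  filter_upwards [eventually_mbMin_close hΞ μ hmn hratio hσ (σu := σu) hε] with m h θ
  have := θ.isProbabilityMeasure_law hΞ μ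
  exact (abs_integral_sub_const_le (h θ).1 _).trans (h θ).2

/-- Always `maxVar ≤ σu ^ 2`, with equality for a single sub-sample of standard deviation `σu`. -/
theorem asympUnbiasedUpper_mbMax (hΞ : IsNoiseClass Ξ) (μ : ℝ) (hmn : ∀ᶠ m in atTop, m < n m)
    (hratio : ∃ C : ℕ, ∀ᶠ m in atTop, n m ≤ C * m) :
    AsympUnbiasedUpper Ξ μ n (fun m x => mbMax m x) := by
  intro σl σu hσ hle
  refine ⟨(eventually_mbMax_close hΞ μ hmn hratio hσ.le (σu := σu) one_pos).mono
    fun m h θ => (h θ).1, tendsto_upperExp_iff.2 fun ε hε => ?_⟩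
  filter_upwards [hmn, asympUnbiasedAt_mbMax hΞ μ hmn hratio σl σu hσ.le hle ε hε] with m h1 h2
  refine ⟨fun θ => ?_, ?_⟩
  · obtain ⟨i, hi⟩ := θ.exists_sd_sq_eq_maxVar (by omega)
    have := (abs_le.1 (h2 θ)).2
    have := θ.sd_sq_le hσ.le i
    linarith
  · obtain ⟨ν, hν⟩ := hΞ.nonempty
    refine ⟨Config.single hν (Set.right_mem_Icc.2 hle) h1, ?_⟩
    have := (abs_le.1 (h2 (Config.single hν (Set.right_mem_Icc.2 hle) h1))).1
    rw [Config.maxVar_single] at this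
    linarith

theorem asympUnbiasedLower_mbMin (hΞ : IsNoiseClass Ξ) (μ : ℝ) (hmn : ∀ᶠ m in atTop, m < n m)
    (hratio : ∃ C : ℕ, ∀ᶠ m in atTop, n m ≤ C * m) :
    AsympUnbiasedLower Ξ μ n (fun m x => mbMin m x) := by
  intro σl σu hσ hle
  refine ⟨(eventually_mbMin_close hΞ μ hmn hratio hσ.le (σu := σu) one_pos).mono
    fun m h θ => (h θ).1, (tendsto_neg_upperExp_neg_iff (T := fun m x => mbMin m x)).2
      fun ε hε => ?_⟩
  filter_upwards [hmn, asympUnbiasedAt_mbMin hΞ μ hmn hratio σl σu hσ.le hle ε hε] with m h1 h2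
  refine ⟨fun θ => ?_, ?_⟩
  · obtain ⟨i, hi⟩ := θ.exists_sd_sq_eq_minVar (by omega)
    have := (abs_le.1 (h2 θ)).1
    have := θ.le_sd_sq hσ.le i
    linarith
  · obtain ⟨ν, hν⟩ := hΞ.nonempty
    refine ⟨Config.single hν (Set.left_mem_Icc.2 hle) h1, ?_⟩
    have := (abs_le.1 (h2 (Config.single hν (Set.left_mem_Icc.2 hle) h1))).2
    rw [Config.minVar_single] at this
    linarith

/-! ### Optimality among unbiased statistics. -/

/-- An asymptotically unbiased statistic for the upper variance has, uniformly over all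
configurations, asymptotically at most the mean `maxVar`. -/
theorem AsympUnbiasedUpper.eventually_integral_le {μ : ℝ} {T : Statistic n}
    (hT : AsympUnbiasedUpper Ξ μ n T) (hmn : ∀ᶠ m in atTop, m < n m) (hσ : 0 < σl)
    {ε : ℝ} (hε : 0 < ε) :
    ∀ᶠ m in atTop, ∀ θ : Config Ξ σl σu (n m) m, ∫ x, T m x ∂(θ.law μ) ≤ θ.maxVar + ε := by
  set δ := ε / 2 with hδdef
  have hδ : 0 < δ := by positivity
  -- Unbiasedness gives a threshold for `m` that depends on the bounds. A finite grid of upper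
  -- bounds, with variances spaced by `δ`, yields a common threshold.
  set s : ℕ → ℝ := fun k => √(σl ^ 2 + k * δ) with hs
  have hs2 : ∀ k, s k ^ 2 = σl ^ 2 + k * δ := fun k => Real.sq_sqrt (by positivity)
  have hsl : ∀ k, σl ≤ s k := fun k => Real.le_sqrt_of_sq_le (by
    have : 0 ≤ k * δ := by positivity
    linarith)
  set N := ⌈(σu ^ 2 - σl ^ 2) / δ⌉₊ with hN
  have hgrid : ∀ᶠ m in atTop, ∀ k ∈ Finset.range (N + 1), ∀ θ : Config Ξ σl (s k) (n m) m,
      ∫ x, T m x ∂(θ.law μ) ≤ s k ^ 2 + δ := by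
    rw [Filter.eventually_all_finset]
    intro k _
    exact (tendsto_upperExp_iff.1 (hT σl (s k) hσ (hsl k)).2 δ hδ).mono fun m h => h.1
  filter_upwards [hmn, hgrid] with m hm h θ
  obtain ⟨i, hi⟩ := θ.exists_sd_sq_eq_maxVar (by omega)
  have h1 := θ.le_sd_sq hσ.le i
  have h2 := θ.sd_sq_le hσ.le i
  rw [hi] at h1 h2
  -- The first grid variance not below `maxVar`: `θ` satisfies the bound `s k`, and `s k ^ 2 <
  -- maxVar + δ`.
  set k := ⌈(θ.maxVar - σl ^ 2) / δ⌉₊ with hk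
  have hkN : k ∈ Finset.range (N + 1) := by
    rw [Finset.mem_range, Nat.lt_succ_iff]
    exact Nat.ceil_mono (div_le_div_of_nonneg_right (by linarith) hδ.le)
  have hk1 : θ.maxVar - σl ^ 2 ≤ k * δ := (div_le_iff₀ hδ).1 (Nat.le_ceil _)
  have hk2 : (k : ℝ) * δ < θ.maxVar - σl ^ 2 + δ := by
    have := Nat.ceil_lt_add_one (a := (θ.maxVar - σl ^ 2) / δ)
      (div_nonneg (by linarith) hδ.le)
    have := mul_lt_mul_of_pos_right this hδ
    rwa [add_mul, div_mul_cancel₀ _ hδ.ne', one_mul] at this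
  have hb : ∀ i, θ.sd i ∈ Set.Icc σl (s k) := fun i =>
    ⟨(θ.sd_mem i).1, Real.le_sqrt_of_sq_le (by linarith [θ.le_maxVar i])⟩
  have := h k hkN (θ.withBounds hb)
  rw [Config.law_withBounds, hs2] at this
  linarith

/-- An asymptotically unbiased statistic for the lower variance has, uniformly over all
configurations, asymptotically at least the mean `minVar`. -/
theorem AsympUnbiasedLower.eventually_le_integral {μ : ℝ} {T : Statistic n}
    (hT : AsympUnbiasedLower Ξ μ n T) (hmn : ∀ᶠ m in atTop, m < n m) (hσ : 0 < σl)
    (hle : σl ≤ σu) {ε : ℝ} (hε : 0 < ε) :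
    ∀ᶠ m in atTop, ∀ θ : Config Ξ σl σu (n m) m, θ.minVar - ε ≤ ∫ x, T m x ∂(θ.law μ) := by
  set δ := ε / 2 with hδdef
  have hδ : 0 < δ := by positivity
  set s : ℕ → ℝ := fun k => √(σl ^ 2 + k * δ) with hs
  have hs2 : ∀ k, s k ^ 2 = σl ^ 2 + k * δ := fun k => Real.sq_sqrt (by positivity)
  have hsl : ∀ k, σl ≤ s k := fun k => Real.le_sqrt_of_sq_le (by
    have : 0 ≤ k * δ := by positivity
    linarith)
  -- Rounding is now downwards: the grid points serve as lower bounds, and unbiasedness may be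
  -- invoked only if `s k ≤ σu`.
  set N := ⌊(σu ^ 2 - σl ^ 2) / δ⌋₊ with hN
  have hgrid : ∀ᶠ m in atTop, ∀ k ∈ Finset.range (N + 1), ∀ θ : Config Ξ (s k) σu (n m) m,
      s k ^ 2 - δ ≤ ∫ x, T m x ∂(θ.law μ) := by
    rw [Filter.eventually_all_finset]
    intro k hk
    have hsk : s k ≤ σu := by
      refine Real.sqrt_le_iff.2 ⟨hσ.le.trans hle, ?_⟩
      have h0 : 0 ≤ (σu ^ 2 - σl ^ 2) / δ :=
        div_nonneg (sub_nonneg.2 (pow_le_pow_left₀ hσ.le hle 2)) hδ.le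
      have := (Nat.le_floor_iff h0).1 (Nat.lt_succ_iff.1 (Finset.mem_range.1 hk))
      rw [le_div_iff₀ hδ] at this
      linarith
    exact (tendsto_neg_upperExp_neg_iff.1 (hT (s k) σu (hσ.trans_le (hsl k)) hsk).2 δ hδ).mono
      fun m h => h.1
  filter_upwards [hmn, hgrid] with m hm h θ
  obtain ⟨i, hi⟩ := θ.exists_sd_sq_eq_minVar (by omega)
  have h1 := θ.le_sd_sq hσ.le i
  have h2 := θ.sd_sq_le hσ.le i
  rw [hi] at h1 h2
  set k := ⌊(θ.minVar - σl ^ 2) / δ⌋₊ with hk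
  have hkN : k ∈ Finset.range (N + 1) := by
    rw [Finset.mem_range, Nat.lt_succ_iff]
    exact Nat.floor_mono (div_le_div_of_nonneg_right (by linarith) hδ.le)
  have hk1 : k * δ ≤ θ.minVar - σl ^ 2 :=
    (le_div_iff₀ hδ).1 (Nat.floor_le (div_nonneg (by linarith) hδ.le))
  have hk2 : θ.minVar - σl ^ 2 < k * δ + δ := by
    have := (div_lt_iff₀ hδ).1 (Nat.lt_floor_add_one ((θ.minVar - σl ^ 2) / δ))
    rwa [add_mul, one_mul] at this
  have hb : ∀ i, θ.sd i ∈ Set.Icc (s k) σu := fun i =>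
    ⟨Real.sqrt_le_iff.2 ⟨hσ.le.trans (θ.sd_mem i).1, by linarith [θ.minVar_le i]⟩, (θ.sd_mem i).2⟩
  have := h k hkN (θ.withBounds hb)
  rw [Config.law_withBounds, hs2] at this
  linarith

/-- The limit from below is free by nonnegativity, but some configuration must exist, since an empty
supremum would be `⊥`. -/
lemma asympLE_of_eventually {μ : ℝ} {T U : Statistic n} (hmn : ∀ᶠ m in atTop, m < n m)
    (hΞ : IsNoiseClass Ξ)
    (h : ∀ σl σu : ℝ, 0 < σl → σl ≤ σu → ∀ ε > 0, ∀ᶠ m in atTop, ∀ θ : Config Ξ σl σu (n m) m,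
      Integrable (fun x => max (T m x - U m x) 0) (θ.law μ) ∧
        ∫ x, max (T m x - U m x) 0 ∂(θ.law μ) ≤ ε) :
    AsympLE Ξ μ n T U := by
  intro σl σu hσ hle
  refine ⟨(h σl σu hσ hle 1 one_pos).mono fun m hm θ => (hm θ).1, ?_⟩
  rw [← EReal.coe_zero]
  refine (tendsto_upperExp_iff (T := fun m x => max (T m x - U m x) 0)).2 fun ε hε => ?_
  filter_upwards [hmn, h σl σu hσ hle ε hε] with m h1 h2
  refine ⟨fun θ => by simpa using (h2 θ).2, ?_⟩
  obtain ⟨ν, hν⟩ := hΞ.nonempty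
  refine ⟨Config.single hν (Set.right_mem_Icc.2 hle) h1, ?_⟩
  have := integral_nonneg (μ := (Config.single hν (Set.right_mem_Icc.2 hle) h1).law μ)
    (f := fun x => max (T m x - U m x) 0) fun x => le_max_right _ _
  linarith

theorem AsympUnbiasedUpper.asympLE_mbMax (hΞ : IsNoiseClass Ξ) {μ : ℝ}
    (hmn : ∀ᶠ m in atTop, m < n m) (hratio : ∃ C : ℕ, ∀ᶠ m in atTop, n m ≤ C * m)
    {T : Statistic n} (hL : IsLipschitzBlockStatistic n T) (hT : AsympUnbiasedUpper Ξ μ n T) :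
    AsympLE Ξ μ n T (fun m x => mbMax m x) := by
  obtain ⟨K, f, hf, hTf⟩ := hL
  refine asympLE_of_eventually hmn hΞ fun σl σu hσ hle ε hε => ?_
  filter_upwards [hT.eventually_integral_le hmn hσ (σu := σu) (ε := ε / 4) (by positivity),
    eventually_lipschitz_close hΞ μ hmn hratio hσ.le (σu := σu) hf (ε := ε / 4) (by positivity),
    eventually_mbMax_close hΞ μ hmn hratio hσ.le (σu := σu) (ε := ε / 4) (by positivity)]
    with m h1 h2 h3 θ
  have := θ.isProbabilityMeasure_law hΞ μ
  obtain ⟨h2a, h2b⟩ := h2 θ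
  obtain ⟨h3a, h3b⟩ := h3 θ
  have h1' := h1 θ
  simp only [hTf] at h1' ⊢
  -- The constant near which `T` concentrates is within `ε / 4` of its mean, hence at most `maxVar +
  -- ε / 2`; the two `L¹` errors use up the other `ε / 2`.
  have h4 := (abs_le.1 (abs_integral_sub_const_le h2a (f m θ.blockAvg))).1
  refine ⟨(h2a.sub h3a).pos_part, ?_⟩
  have := integral_max_sub_le h2a h3a (a := f m θ.blockAvg) (b := θ.maxVar) (ε := ε / 2)
    (by positivity) (by linarith)
  linarith

theorem AsympUnbiasedLower.mbMin_asympLE (hΞ : IsNoiseClass Ξ) {μ : ℝ}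
    (hmn : ∀ᶠ m in atTop, m < n m) (hratio : ∃ C : ℕ, ∀ᶠ m in atTop, n m ≤ C * m)
    {T : Statistic n} (hL : IsLipschitzBlockStatistic n T) (hT : AsympUnbiasedLower Ξ μ n T) :
    AsympLE Ξ μ n (fun m x => mbMin m x) T := by
  obtain ⟨K, f, hf, hTf⟩ := hL
  refine asympLE_of_eventually hmn hΞ fun σl σu hσ hle ε hε => ?_
  filter_upwards [hT.eventually_le_integral hmn hσ hle (ε := ε / 4) (by positivity),
    eventually_lipschitz_close hΞ μ hmn hratio hσ.le (σu := σu) hf (ε := ε / 4) (by positivity),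
    eventually_mbMin_close hΞ μ hmn hratio hσ.le (σu := σu) (ε := ε / 4) (by positivity)]
    with m h1 h2 h3 θ
  have := θ.isProbabilityMeasure_law hΞ μ
  obtain ⟨h2a, h2b⟩ := h2 θ
  obtain ⟨h3a, h3b⟩ := h3 θ
  have h1' := h1 θ
  simp only [hTf] at h1' ⊢
  have h4 := (abs_le.1 (abs_integral_sub_const_le h2a (f m θ.blockAvg))).2
  refine ⟨(h3a.sub h2a).pos_part, ?_⟩
  have := integral_max_sub_le h3a h2a (a := θ.minVar) (b := f m θ.blockAvg) (ε := ε / 2)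
    (by positivity) (by linarith)
  linarith

theorem AsympUnbiasedUpper.asympLEMean_mbMax (hΞ : IsNoiseClass Ξ) {μ : ℝ}
    (hmn : ∀ᶠ m in atTop, m < n m) (hratio : ∃ C : ℕ, ∀ᶠ m in atTop, n m ≤ C * m)
    {T : Statistic n} (hT : AsympUnbiasedUpper Ξ μ n T) :
    AsympLEMean Ξ μ n T (fun m x => mbMax m x) := by
  intro σl σu hσ hle ε hε
  filter_upwards [hT.eventually_integral_le hmn hσ (σu := σu) (half_pos hε),
    asympUnbiasedAt_mbMax hΞ μ hmn hratio σl σu hσ.le hle _ (half_pos hε)] with m h1 h2 θ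
  linarith [h1 θ, (abs_le.1 (h2 θ)).1]

theorem AsympUnbiasedLower.mbMin_asympLEMean (hΞ : IsNoiseClass Ξ) {μ : ℝ}
    (hmn : ∀ᶠ m in atTop, m < n m) (hratio : ∃ C : ℕ, ∀ᶠ m in atTop, n m ≤ C * m)
    {T : Statistic n} (hT : AsympUnbiasedLower Ξ μ n T) :
    AsympLEMean Ξ μ n (fun m x => mbMin m x) T := by
  intro σl σu hσ hle ε hε
  filter_upwards [hT.eventually_le_integral hmn hσ hle (half_pos hε),
    asympUnbiasedAt_mbMin hΞ μ hmn hratio σl σu hσ.le hle _ (half_pos hε)] with m h1 h2 θ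
  linarith [h1 θ, (abs_le.1 (h2 θ)).2]

end MovingBlock

end

theorem mainTheorem4 (Ξ : Set (Measure ℝ)) (hΞ : MovingBlock.IsNoiseClass Ξ) (μ : ℝ)
    (n : ℕ → ℕ) (hmn : ∀ᶠ m in atTop, m < n m)
    (hratio : ∃ C : ℕ, ∀ᶠ m in atTop, n m ≤ C * m) :
    (MovingBlock.IsAsympLargestUnbiasedUpper Ξ μ n (fun m x => MovingBlock.mbMax m x) ∧
      MovingBlock.AsympUnbiasedAt Ξ μ n (fun m x => MovingBlock.mbMax m x)
        (fun θ => θ.maxVar)) ∧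
    (MovingBlock.IsAsympSmallestUnbiasedLower Ξ μ n (fun m x => MovingBlock.mbMin m x) ∧
      MovingBlock.AsympUnbiasedAt Ξ μ n (fun m x => MovingBlock.mbMin m x)
        (fun θ => θ.minVar)) := by
  open MovingBlock in
  exact ⟨⟨⟨isLipschitzBlockStatistic_mbMax n, asympUnbiasedUpper_mbMax hΞ μ hmn hratio,
    fun _ hL hT => hT.asympLE_mbMax hΞ hmn hratio hL,
    fun _ hT => hT.asympLEMean_mbMax hΞ hmn hratio⟩, asympUnbiasedAt_mbMax hΞ μ hmn hratio⟩,
    ⟨isLipschitzBlockStatistic_mbMin n, asympUnbiasedLower_mbMin hΞ μ hmn hratio,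
    fun _ hL hT => hT.mbMin_asympLE hΞ hmn hratio hL,
    fun _ hT => hT.mbMin_asympLEMean hΞ hmn hratio⟩, asympUnbiasedAt_mbMin hΞ μ hmn hratio⟩
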